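/- Let $C$ be a category, and let $\mathcal F=\mathrm{Hom}(C^{\mathrm{op}},\mathrm{Cat})$ be the bicategory of pseudofunctors $C^{\mathrm{op}}\to\mathrm{Cat}$, pseudonatural transformations and modifications, where $\mathrm{Cat}$ is taken in universes large enough to contain the hom-sets of $C$ as discrete categories. An object $T$ of $C$ is also regarded as the representable object $C(-,T)$ of $\mathcal F$, with values in discrete categories. A morphism $f:Y\to X$ of $\mathcal F$ is called *e.s.o.* (respectively *f.f.*) if every component functor $f_W:YW\to XW$ is essentially surjective on objects (respectively fully faithful). Let $X$ be an object of $\mathcal F$, let $T,V,U$ be objects of $C$, let $t$ be an object of the category $XT$, and let $e:V\to U$ be a morphism of $C$. Let $V\xrightarrow{s}P\xrightarrow{e'}U$ be morphisms of $\mathcal F$ which form a factorization of $e$ up to isomorphism, $e's\cong e$, and which are of *effective descent* for $X$: that is, $s$ is e.s.o. and the functor $XU\to\mathcal F(P,X)$ which sends an object $x$ to the composite of $e':P\to U$ with the morphism $U\to X$ corresponding to $x$ is an equivalence of categories. Let $X[t]$ be the e.s.o./f.f. image of $t$: that is, let $T\xrightarrow{s_t}X[t]\xrightarrow{j_t}X$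 be any factorization in $\mathcal F$, up to isomorphism, of the morphism $T\to X$, $z\mapsto (Xz)t$, corresponding to $t$, with $s_t$ e.s.o. and $j_t$ f.f. Let $\mathrm{Loc}(t;e)$ be the full subcategory of $XU$ consisting of the objects $x$ for which there exist a morphism $z:V\to T$ in $C$ and an isomorphism $(Xe)x\cong (Xz)t$ in $XV$. Then there is an equivalence of categories $$\mathcal F(P,X[t])\simeq \mathrm{Loc}(t;e).$$ -/

import Mathlib

open CategoryTheory Bicategory Opposite
open scoped CategoryTheory.Pseudofunctor.StrongTrans

universe w w' v u

namespace LocTriv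

/-- A category parametrized by `C`: a pseudofunctor `Cᵒᵖ ⥤ᵖ Cat`. These are the objects of the
bicategory `𝓕 = Hom(Cᵒᵖ, Cat)`, whose 1-cells are the pseudonatural transformations and whose
2-cells are the modifications. The universe of objects of the categories in `Cat` is only required
to be large enough for the hom-sets of `C` to be (discrete) objects of `Cat`. -/
abbrev ParamCat (C : Type u) [Category.{v} C] :=
  Pseudofunctor (LocallyDiscrete Cᵒᵖ) Cat.{w, max v w'}

section Representable

variable {C : Type u} [Category.{v} C]

/-- The objects of the discrete category `C(V, T)`. -/
structure HomObj (V T : C) : Type (max v w') where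
  /-- the underlying morphism of `C` -/
  hom : V ⟶ T

/-- `C(V, T)` as a discrete category, with hom-sets placed in the universe `w`. -/
instance homObjCategory (V T : C) : Category.{w} (HomObj.{w', v, u} V T) where
  Hom a b := ULift.{w} (PLift (a = b))
  id _ := ⟨⟨rfl⟩⟩
  comp f g := ⟨⟨f.down.down.trans g.down.down⟩⟩

instance homObjHomSubsingleton {V T : C} (a b : HomObj.{w', v, u} V T) :
    Subsingleton (@Quiver.Hom _ (homObjCategory.{w, w', v, u} V T).toQuiver a b) :=
  inferInstanceAs (Subsingleton (ULift.{w} (PLift (a = b))))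

/-- The isomorphism of `C(V, T)` given by an equality. -/
def homObjIso {V T : C} {a b : HomObj.{w', v, u} V T} (h : a = b) :
    @Iso _ (homObjCategory.{w, w', v, u} V T) a b where
  hom := ⟨⟨h⟩⟩
  inv := ⟨⟨h.symm⟩⟩
  hom_inv_id := Subsingleton.elim _ _
  inv_hom_id := Subsingleton.elim _ _

/-- The functor `C(V, T) ⥤ C(W, T)` given by precomposition with `f : W ⟶ V`. -/
def precompHom (T : C) {V W : C} (f : W ⟶ V) :
    @Functor (HomObj.{w', v, u} V T) (homObjCategory.{w, w', v, u} V T)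
      (HomObj.{w', v, u} W T) (homObjCategory.{w, w', v, u} W T) where
  obj z := ⟨f ≫ z.hom⟩
  map φ := ⟨⟨by rw [φ.down.down]⟩⟩
  map_id _ := Subsingleton.elim _ _
  map_comp _ _ := Subsingleton.elim _ _

/-- Two natural transformations between the same functors into `C(V, T)` are equal. -/
theorem hom₂_eq {D : Cat.{w, max v w'}} {V T : C}
    {F G : D ⟶ Cat.of (HomObj.{w', v, u} V T)} (α β : F ⟶ G) : α = β := by
  apply Cat.Hom₂.ext
  apply NatTrans.ext
  funext x
  exact homObjHomSubsingleton.{w, w', v, u} _ _ |>.elim _ _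

/-- The representable object `C(-, T)` of `𝓕`, with values in discrete categories. -/
def rep (T : C) : ParamCat.{w, w', v, u} C :=
  pseudofunctorOfIsLocallyDiscrete
    (fun V => Cat.of (HomObj.{w', v, u} V.as.unop T))
    (fun f => (precompHom T f.as.unop).toCatHom)
    (fun _ => Cat.Hom.isoMk (NatIso.ofComponents
      (fun z => homObjIso (congrArg HomObj.mk (Category.id_comp z.hom)))
      (fun _ => Subsingleton.elim _ _)))
    (fun f g => Cat.Hom.isoMk (NatIso.ofComponents
      (fun z => homObjIso (congrArg HomObj.mk (Category.assoc g.as.unop f.as.unop z.hom)))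
      (fun _ => Subsingleton.elim _ _)))
    (fun _ _ _ => hom₂_eq _ _)
    (fun _ => hom₂_eq _ _)
    (fun _ => hom₂_eq _ _)

/-- The object `(Xz)t` of `XV`, for `z : V ⟶ T` and an object `t` of `XT`. -/
abbrev pullObj (X : ParamCat.{w, w', v, u} C) {V T : C} (z : V ⟶ T) (t : X.obj ⟨op T⟩) :
    X.obj ⟨op V⟩ :=
  (X.map z.op.toLoc).toFunctor.obj t

theorem map₂_app_eq (X : ParamCat.{w, w', v, u} C) {a b : LocallyDiscrete Cᵒᵖ} {f g : a ⟶ b}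
    (η : f ⟶ g) (t : X.obj a) :
    (X.map₂ η).toNatTrans.app t =
      eqToHom (congrArg (fun h => (X.map h).toFunctor.obj t) (LocallyDiscrete.eq_of_hom η)) := by
  obtain rfl := LocallyDiscrete.eq_of_hom η
  obtain rfl : η = 𝟙 _ := Subsingleton.elim _ _
  rw [PrelaxFunctor.map₂_id]
  rfl

/-- The functor `t_V : C(V, T) ⥤ XV`, `z ↦ (Xz)t`. -/
def familyApp (X : ParamCat.{w, w', v, u} C) {T : C} (t : X.obj ⟨op T⟩) (V : C) :
    @Functor (HomObj.{w', v, u} V T) (homObjCategory.{w, w', v, u} V T) (X.obj ⟨op V⟩) _ where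
  obj z := pullObj X z.hom t
  map φ := eqToHom (by rw [φ.down.down])
  map_id _ := rfl
  map_comp _ _ := (eqToHom_trans _ _).symm

/-- The morphism `C(-, T) ⟶ X` of `𝓕` corresponding to an object `t` of `XT`
under the bicategorical Yoneda lemma: `z ↦ (Xz)t`. -/
def family (X : ParamCat.{w, w', v, u} C) {T : C} (t : X.obj ⟨op T⟩) :
    rep.{w, w', v, u} T ⟶ X where
  app V := (familyApp X t V.as.unop).toCatHom
  naturality {V W} f := Cat.Hom.isoMk (NatIso.ofComponents
    (fun z => (Cat.Hom.toNatIso (X.mapComp z.hom.op.toLoc f)).app t)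
    (fun {z z'} φ => by
      obtain ⟨⟨rfl⟩⟩ := φ
      refine Eq.trans (b := (X.mapComp z.hom.op.toLoc f).hom.toNatTrans.app t) ?_ ?_
      · exact Category.id_comp _
      · refine ((congrArg _ ?_).trans (Category.comp_id _)).symm
        exact (X.map f).toFunctor.map_id _))
  naturality_naturality {V W f g} η := by
    obtain rfl := obj_ext_of_isDiscrete η
    obtain rfl : η = 𝟙 _ := Subsingleton.elim _ _
    apply Cat.Hom₂.ext
    apply NatTrans.ext
    funext z
    rw [PrelaxFunctor.map₂_id, PrelaxFunctor.map₂_id]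
    exact (Category.id_comp _).trans (Category.comp_id _).symm
  naturality_id V := by
    apply Cat.Hom₂.ext
    apply NatTrans.ext
    funext z
    refine Eq.trans (b := (X.map₂ (ρ_ z.hom.op.toLoc).hom).toNatTrans.app t) ?_ ?_
    · change (X.mapComp z.hom.op.toLoc (𝟙 V)).hom.toNatTrans.app t ≫
        (X.mapId V).hom.toNatTrans.app (pullObj X z.hom t) = _
      rw [Pseudofunctor.mapComp_id_right_hom_app]
      exact (Category.assoc _ _ _).trans ((congrArg _ (Cat.Hom.inv_hom_id_toNatTrans_app _ _)).trans
        (Category.comp_id _))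
    · rw [map₂_app_eq]
      exact ((congrArg _ (Category.id_comp _)).trans (Category.comp_id _)).symm
  naturality_comp f g := by
    apply Cat.Hom₂.ext
    apply NatTrans.ext
    funext z
    change (X.mapComp z.hom.op.toLoc (f ≫ g)).hom.toNatTrans.app t ≫
        (X.mapComp f g).hom.toNatTrans.app (pullObj X z.hom t) =
      eqToHom (congrArg (fun h => (X.map h).toFunctor.obj t)
          (LocallyDiscrete.eq_of_hom (α_ z.hom.op.toLoc f g).inv)) ≫
        𝟙 _ ≫ (X.mapComp (z.hom.op.toLoc ≫ f) g).hom.toNatTrans.app t ≫ 𝟙 _ ≫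
        (X.map g).toFunctor.map ((X.mapComp z.hom.op.toLoc f).hom.toNatTrans.app t) ≫ 𝟙 _
    rw [Pseudofunctor.mapComp_assoc_right_hom_app, map₂_app_eq]
    refine congrArg _ ?_
    refine Eq.trans ?_ (Category.id_comp _).symm
    exact congrArg _ ((Category.id_comp _).trans (Category.comp_id _)).symm

/-- A morphism `f : t ⟶ t'` of `XT` induces a modification `family X t ⟶ family X t'`
with components `(Xz)f`. -/
def familyMap (X : ParamCat.{w, w', v, u} C) {T : C} {t t' : X.obj ⟨op T⟩} (f : t ⟶ t') :
    family X t ⟶ family X t' where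
  as := {
    app V := Cat.Hom₂.ofNatTrans
      { app := fun z => (X.map z.hom.op.toLoc).toFunctor.map f
        naturality := fun {z z'} φ => by
          obtain ⟨⟨rfl⟩⟩ := φ
          exact (Category.id_comp _).trans (Category.comp_id _).symm }
    naturality {V W} g := by
      apply Cat.Hom₂.ext
      apply NatTrans.ext
      funext z
      exact (X.mapComp z.hom.op.toLoc g).hom.toNatTrans.naturality f }

/-- The functor `XU ⥤ 𝓕(U, X)` of the bicategorical Yoneda lemma (an equivalence of categories). -/
def familyFunctor (X : ParamCat.{w, w', v, u} C) (U : C) :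
    X.obj ⟨op U⟩ ⥤ (rep.{w, w', v, u} U ⟶ X) where
  obj x := family X x
  map f := familyMap X f
  map_id x := by
    ext V z
    exact (X.map _).toFunctor.map_id _
  map_comp f g := by
    ext V z
    exact (X.map _).toFunctor.map_comp _ _

/-- The morphism `C(-, V) ⟶ C(-, U)` of `𝓕` given by composition with `e : V ⟶ U`. -/
def repMap {V U : C} (e : V ⟶ U) : rep.{w, w', v, u} V ⟶ rep.{w, w', v, u} U where
  app W := Functor.toCatHom
    { obj := fun z => (⟨z.hom ≫ e⟩ : HomObj.{w', v, u} W.as.unop U)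
      map := fun φ => ⟨⟨by rw [φ.down.down]⟩⟩
      map_id := fun _ => Subsingleton.elim _ _
      map_comp := fun _ _ => Subsingleton.elim _ _ }
  naturality f := Cat.Hom.isoMk (NatIso.ofComponents
    (fun z => homObjIso (congrArg HomObj.mk (Category.assoc f.as.unop z.hom e)))
    (fun _ => (homObjHomSubsingleton.{w, w', v, u} _ _).elim _ _))
  naturality_naturality _ := hom₂_eq _ _
  naturality_id _ := hom₂_eq _ _
  naturality_comp _ _ := hom₂_eq _ _

end Representable

section Factorization

variable {C : Type u} [Category.{v} C]

/-- A morphism of `𝓕` is e.s.o. when it is pointwise essentially surjective on objects. -/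
def IsEso {X Y : ParamCat.{w, w', v, u} C} (f : X ⟶ Y) : Prop :=
  ∀ U, (f.app U).toFunctor.EssSurj

/-- A morphism of `𝓕` is f.f. when it is pointwise fully faithful. -/
def IsFf {X Y : ParamCat.{w, w', v, u} C} (f : X ⟶ Y) : Prop :=
  ∀ U, (f.app U).toFunctor.Full ∧ (f.app U).toFunctor.Faithful

/-- A factorization `f ≅ s ≫ j` in `𝓕` with `s` e.s.o. and `j` f.f.; the object `obj` is the
e.s.o./f.f. image of `f`, which is determined up to equivalence. -/
structure EsoFfFactorization {X Y : ParamCat.{w, w', v, u} C} (f : X ⟶ Y) where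
  /-- the image -/
  obj : ParamCat.{w, w', v, u} C
  /-- the e.s.o. part -/
  s : X ⟶ obj
  /-- the f.f. part -/
  j : obj ⟶ Y
  /-- the invertible 2-cell -/
  iso : s ≫ j ≅ f
  /-- `s` is e.s.o. -/
  eso : IsEso s
  /-- `j` is f.f. -/
  ff : IsFf j

/-- The objects of `YU` isomorphic to one in the image of `f_U`. -/
def imageProperty {X Y : ParamCat.{w, w', v, u} C} (f : X ⟶ Y) : Y.ObjectProperty where
  prop U := (f.app U).toFunctor.essImage

instance {X Y : ParamCat.{w, w', v, u} C} (f : X ⟶ Y) :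
    (imageProperty f).IsClosedUnderMapObj where
  map_obj := by
    rintro U V y ⟨x, ⟨i⟩⟩ g
    exact ⟨(X.map g).toFunctor.obj x,
      ⟨(Cat.Hom.toNatIso (f.naturality g)).app x ≪≫ (Y.map g).toFunctor.mapIso i⟩⟩

/-- Every morphism of `𝓕` has an e.s.o./f.f. factorization, through its pointwise full image. -/
def imageFactorization {X Y : ParamCat.{w, w', v, u} C} (f : X ⟶ Y) : EsoFfFactorization f where
  obj := (imageProperty f).fullsubcategory
  s := {
    app U := Functor.toCatHom
      (ObjectProperty.lift _ (f.app U).toFunctor (fun x => Functor.obj_mem_essImage _ x))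
    naturality g := Cat.Hom.isoMk (NatIso.ofComponents
      (fun x => ObjectProperty.isoMk _ ((Cat.Hom.toNatIso (f.naturality g)).app x))
      (fun φ => ObjectProperty.hom_ext _ ((f.naturality g).hom.toNatTrans.naturality φ)))
    naturality_naturality η := by
      ext x
      exact ObjectProperty.hom_ext _
        (congrArg (fun k => k.toNatTrans.app x) (f.naturality_naturality η))
    naturality_id U := by
      ext x
      exact ObjectProperty.hom_ext _ (congrArg (fun k => k.toNatTrans.app x) (f.naturality_id U))
    naturality_comp g h := by
      ext x
      exact ObjectProperty.hom_ext _
        (congrArg (fun k => k.toNatTrans.app x) (f.naturality_comp g h)) }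
  j := Pseudofunctor.ObjectProperty.ι _
  iso := Pseudofunctor.StrongTrans.isoMk (fun U => Cat.Hom.isoMk (Iso.refl _)) (by
    intro U V g
    ext x
    change 𝟙 _ ≫ (f.naturality g).hom.toNatTrans.app x =
      (𝟙 _ ≫ (f.naturality g).hom.toNatTrans.app x ≫ 𝟙 _ ≫ 𝟙 _ ≫ 𝟙 _) ≫
        (Y.map g).toFunctor.map (𝟙 _)
    simp only [Category.id_comp, Category.comp_id, CategoryTheory.Functor.map_id]
    exact (Category.comp_id _).symm)
  eso U := ⟨by
    rintro ⟨y, x, ⟨i⟩⟩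
    exact ⟨x, ⟨ObjectProperty.isoMk _ i⟩⟩⟩
  ff U := ⟨inferInstanceAs (ObjectProperty.ι _).Full, inferInstanceAs (ObjectProperty.ι _).Faithful⟩

end Factorization

section Descent

variable {C : Type u} [Category.{v} C]

/-- The functor `XU ⥤ 𝓕(P, X)` induced by `e' : P ⟶ U`. -/
def inducedFunctor (X : ParamCat.{w, w', v, u} C) {U : C} {P : ParamCat.{w, w', v, u} C}
    (e' : P ⟶ rep.{w, w', v, u} U) : X.obj ⟨op U⟩ ⥤ (P ⟶ X) :=
  familyFunctor X U ⋙ Bicategory.precomp X e'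

/-- The pair `s : V ⟶ P`, `e' : P ⟶ U` is a factorization of `e : V ⟶ U` in `𝓕` (up to an
invertible 2-cell) which is of effective descent for `X`. -/
structure IsEffectiveDescent (X : ParamCat.{w, w', v, u} C) {V U : C} (e : V ⟶ U)
    {P : ParamCat.{w, w', v, u} C} (s : rep.{w, w', v, u} V ⟶ P)
    (e' : P ⟶ rep.{w, w', v, u} U) : Prop where
  fac : Nonempty (s ≫ e' ≅ repMap e)
  eso : IsEso s
  equiv : (inducedFunctor X e').IsEquivalence

/-- The objects `x` of `XU` for which there are `z : V ⟶ T` and an isomorphism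
`(Xe)x ≅ (Xz)t`. -/
def locProperty (X : ParamCat.{w, w', v, u} C) {T V U : C} (t : X.obj ⟨op T⟩) (e : V ⟶ U) :
    ObjectProperty (X.obj ⟨op U⟩) :=
  fun x => ∃ z : V ⟶ T, Nonempty (pullObj X e x ≅ pullObj X z t)

/-- `Loc(t; e)`, as a full subcategory of `XU`. -/
abbrev Loc (X : ParamCat.{w, w', v, u} C) {T V U : C} (t : X.obj ⟨op T⟩) (e : V ⟶ U) :=
  (locProperty X t e).FullSubcategory

end Descent

end LocTriv

/-! Both sides are the same full subcategory of `𝓕(P, X)`, up to equivalence. Postcomposition with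
the f.f. part `j` of `t` is a fully faithful functor `𝓕(P, X[t]) ⥤ 𝓕(P, X)` (`postcomp_faithful`,
`postcomp_full`). Its essential image consists of the `g` whose values lie pointwise in the
essential image of `j` (`essImage_postcomp_iff`), which is also that of `t`. When `g` corresponds to
`x` in `XU` under descent, one value decides this. As `s` is e.s.o., each object of `P` is
isomorphic to a restriction of `s(1_V)`, and essential images are stable under restriction
(`essImage_of_eso`). Since `e's ≅ e`, the value of `g` at `s(1_V)` is `(Xe)x`, and its lying in the
essential image of `t` at `V` is the condition defining `Loc(t; e)`. -/

namespace CategoryTheory.Pseudofunctor.StrongTrans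

-- Pseudonatural transformations and modifications, object by object.

universe w₁ v₁ u₁ v₂ u₂

variable {B : Type u₁} [Bicategory.{w₁, v₁} B] {F G H : Pseudofunctor B Cat.{v₂, u₂}}

/-- The component at an object of the unit isomorphism of a `Cat`-valued pseudofunctor. -/
def mapIdApp (G : Pseudofunctor B Cat.{v₂, u₂}) (a : B) (x : G.obj a) :
    (G.map (𝟙 a)).toFunctor.obj x ≅ x :=
  (Cat.Hom.toNatIso (G.mapId a)).app x

/-- The component at an object of the composition isomorphism of a `Cat`-valued pseudofunctor. -/
def mapCompApp (G : Pseudofunctor B Cat.{v₂, u₂}) {a b c : B} (f : a ⟶ b) (g : b ⟶ c)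
    (x : G.obj a) :
    (G.map (f ≫ g)).toFunctor.obj x ≅ (G.map g).toFunctor.obj ((G.map f).toFunctor.obj x) :=
  (Cat.Hom.toNatIso (G.mapComp f g)).app x

theorem mapIdApp_naturality (a : B) {x y : G.obj a} (φ : x ⟶ y) :
    (G.map (𝟙 a)).toFunctor.map φ ≫ (mapIdApp G a y).hom = (mapIdApp G a x).hom ≫ φ :=
  (G.mapId a).hom.toNatTrans.naturality φ

theorem mapCompApp_naturality {a b c : B} (f : a ⟶ b) (g : b ⟶ c) {x y : G.obj a} (φ : x ⟶ y) :
    (G.map (f ≫ g)).toFunctor.map φ ≫ (mapCompApp G f g y).hom =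
      (mapCompApp G f g x).hom ≫ (G.map g).toFunctor.map ((G.map f).toFunctor.map φ) :=
  (G.mapComp f g).hom.toNatTrans.naturality φ

/-- The component at an object `x` of the naturality isomorphism of a pseudonatural
transformation between `Cat`-valued pseudofunctors. -/
def natApp (η : F ⟶ G) {a b : B} (f : a ⟶ b) (x : F.obj a) :
    (η.app b).toFunctor.obj ((F.map f).toFunctor.obj x) ≅
      (G.map f).toFunctor.obj ((η.app a).toFunctor.obj x) :=
  (Cat.Hom.toNatIso (η.naturality f)).app x

theorem natApp_naturality (η : F ⟶ G) {a b : B} (f : a ⟶ b) {x y : F.obj a} (φ : x ⟶ y) :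
    (η.app b).toFunctor.map ((F.map f).toFunctor.map φ) ≫ (natApp η f y).hom =
      (natApp η f x).hom ≫ (G.map f).toFunctor.map ((η.app a).toFunctor.map φ) :=
  (η.naturality f).hom.toNatTrans.naturality φ

theorem natApp_map₂ (η : F ⟶ G) {a b : B} {f g : a ⟶ b} (θ : f ⟶ g) (x : F.obj a) :
    (η.app b).toFunctor.map ((F.map₂ θ).toNatTrans.app x) ≫ (natApp η g x).hom =
      (natApp η f x).hom ≫ (G.map₂ θ).toNatTrans.app ((η.app a).toFunctor.obj x) :=
  congrArg (fun k => k.toNatTrans.app x) (η.naturality_naturality θ)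

theorem natApp_id (η : F ⟶ G) (a : B) (x : F.obj a) :
    (natApp η (𝟙 a) x).hom ≫ (mapIdApp G a ((η.app a).toFunctor.obj x)).hom =
      (η.app a).toFunctor.map (mapIdApp F a x).hom := by
  refine (congrArg (fun k => k.toNatTrans.app x) (η.naturality_id a)).trans ?_
  -- The identities are the components of the unitors of `Cat`; associators contribute the ones in
  -- the lemmas below.
  change _ ≫ 𝟙 _ ≫ 𝟙 _ = _
  exact (congrArg _ (Category.comp_id _)).trans (Category.comp_id _)

theorem natApp_comp (η : F ⟶ G) {a b c : B} (f : a ⟶ b) (g : b ⟶ c) (x : F.obj a) :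
    (natApp η (f ≫ g) x).hom ≫
        (mapCompApp G f g ((η.app a).toFunctor.obj x)).hom =
      (η.app c).toFunctor.map (mapCompApp F f g x).hom ≫
        (natApp η g ((F.map f).toFunctor.obj x)).hom ≫
          (G.map g).toFunctor.map (natApp η f x).hom := by
  refine (congrArg (fun k => k.toNatTrans.app x) (η.naturality_comp f g)).trans ?_
  change _ ≫ 𝟙 _ ≫ (natApp η g ((F.map f).toFunctor.obj x)).hom ≫ 𝟙 _ ≫
    (G.map g).toFunctor.map (natApp η f x).hom ≫ 𝟙 _ = _
  refine congrArg _ ((Category.id_comp _).trans (congrArg _ ?_))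
  exact (Category.id_comp _).trans (Category.comp_id _)

theorem natApp_comp_hom (η : F ⟶ G) (θ : G ⟶ H) {a b : B} (f : a ⟶ b) (x : F.obj a) :
    (natApp (η ≫ θ) f x).hom =
      (θ.app b).toFunctor.map (natApp η f x).hom ≫
        (natApp θ f ((η.app a).toFunctor.obj x)).hom := by
  change 𝟙 _ ≫ (θ.app b).toFunctor.map (natApp η f x).hom ≫ 𝟙 _ ≫
    (natApp θ f ((η.app a).toFunctor.obj x)).hom ≫ 𝟙 _ = _
  refine (Category.id_comp _).trans (congrArg _ ?_)
  exact (Category.id_comp _).trans (Category.comp_id _)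

theorem modification_naturality_app {η θ : F ⟶ G} (Γ : η ⟶ θ) {a b : B} (f : a ⟶ b)
    (x : F.obj a) :
    (Γ.as.app b).toNatTrans.app ((F.map f).toFunctor.obj x) ≫ (natApp θ f x).hom =
      (natApp η f x).hom ≫ (G.map f).toFunctor.map ((Γ.as.app a).toNatTrans.app x) :=
  congrArg (fun k => k.toNatTrans.app x) (Γ.as.naturality f)

/-- Two modifications agree if they agree at every object. -/
theorem hom_ext_app {η θ : F ⟶ G} {Γ Γ' : η ⟶ θ}
    (h : ∀ a x, (Γ.as.app a).toNatTrans.app x = (Γ'.as.app a).toNatTrans.app x) : Γ = Γ' :=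
  homCategory.ext fun a => Cat.Hom₂.ext (NatTrans.ext (funext (h a)))

/-- A modification from its components at objects. -/
def homMkApp {η θ : F ⟶ G}
    (app : ∀ a (x : F.obj a), (η.app a).toFunctor.obj x ⟶ (θ.app a).toFunctor.obj x)
    (map : ∀ a {x y : F.obj a} (φ : x ⟶ y),
      (η.app a).toFunctor.map φ ≫ app a y = app a x ≫ (θ.app a).toFunctor.map φ)
    (nat : ∀ {a b : B} (f : a ⟶ b) (x : F.obj a),
      app b ((F.map f).toFunctor.obj x) ≫ (natApp θ f x).hom =
        (natApp η f x).hom ≫ (G.map f).toFunctor.map (app a x)) :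
    η ⟶ θ where
  as := {
    app a := Cat.Hom₂.ofNatTrans { app := app a, naturality := fun _ _ => map a }
    naturality f := Cat.Hom₂.ext (NatTrans.ext (funext (nat f))) }

/-- An invertible modification from its components at objects. -/
def isoMkApp {η θ : F ⟶ G}
    (app : ∀ a (x : F.obj a), (η.app a).toFunctor.obj x ≅ (θ.app a).toFunctor.obj x)
    (map : ∀ a {x y : F.obj a} (φ : x ⟶ y),
      (η.app a).toFunctor.map φ ≫ (app a y).hom = (app a x).hom ≫ (θ.app a).toFunctor.map φ)
    (nat : ∀ {a b : B} (f : a ⟶ b) (x : F.obj a),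
      (app b ((F.map f).toFunctor.obj x)).hom ≫ (natApp θ f x).hom =
        (natApp η f x).hom ≫ (G.map f).toFunctor.map (app a x).hom) :
    η ≅ θ :=
  isoMk (fun a => Cat.Hom.isoMk (NatIso.ofComponents (app a) (map a)))
    (fun f => Cat.Hom₂.ext (NatTrans.ext (funext (nat f))))

/-- The component at an object of an invertible modification. -/
def isoApp {η θ : F ⟶ G} (Γ : η ≅ θ) (a : B) (x : F.obj a) :
    (η.app a).toFunctor.obj x ≅ (θ.app a).toFunctor.obj x where
  hom := (Γ.hom.as.app a).toNatTrans.app x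
  inv := (Γ.inv.as.app a).toNatTrans.app x
  hom_inv_id := congrArg (fun k => (k.as.app a).toNatTrans.app x) Γ.hom_inv_id
  inv_hom_id := congrArg (fun k => (k.as.app a).toNatTrans.app x) Γ.inv_hom_id

/-- A pseudonatural transformation between `Cat`-valued pseudofunctors from its components at
objects. -/
def mkApp (app : ∀ a, F.obj a ⥤ G.obj a)
    (nat : ∀ {a b : B} (f : a ⟶ b) (x : F.obj a),
      (app b).obj ((F.map f).toFunctor.obj x) ≅ (G.map f).toFunctor.obj ((app a).obj x))
    (nat_naturality : ∀ {a b : B} (f : a ⟶ b) {x y : F.obj a} (φ : x ⟶ y),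
      (app b).map ((F.map f).toFunctor.map φ) ≫ (nat f y).hom =
        (nat f x).hom ≫ (G.map f).toFunctor.map ((app a).map φ))
    (nat_map₂ : ∀ {a b : B} {f g : a ⟶ b} (θ : f ⟶ g) (x : F.obj a),
      (app b).map ((F.map₂ θ).toNatTrans.app x) ≫ (nat g x).hom =
        (nat f x).hom ≫ (G.map₂ θ).toNatTrans.app ((app a).obj x))
    (nat_id : ∀ (a : B) (x : F.obj a),
      (nat (𝟙 a) x).hom ≫ (mapIdApp G a ((app a).obj x)).hom =
        (app a).map (mapIdApp F a x).hom)
    (nat_comp : ∀ {a b c : B} (f : a ⟶ b) (g : b ⟶ c) (x : F.obj a),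
      (nat (f ≫ g) x).hom ≫ (mapCompApp G f g ((app a).obj x)).hom =
        (app c).map (mapCompApp F f g x).hom ≫
          (nat g ((F.map f).toFunctor.obj x)).hom ≫ (G.map g).toFunctor.map (nat f x).hom) :
    F ⟶ G where
  app a := (app a).toCatHom
  naturality f := Cat.Hom.isoMk (NatIso.ofComponents (nat f) (nat_naturality f))
  naturality_naturality θ := Cat.Hom₂.ext (NatTrans.ext (funext (nat_map₂ θ)))
  naturality_id a := by
    refine Cat.Hom₂.ext (NatTrans.ext (funext fun x => (nat_id a x).trans ?_))
    change _ = _ ≫ 𝟙 _ ≫ 𝟙 _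
    exact ((congrArg _ (Category.comp_id _)).trans (Category.comp_id _)).symm
  naturality_comp f g := by
    refine Cat.Hom₂.ext (NatTrans.ext (funext fun x => (nat_comp f g x).trans ?_))
    change _ = _ ≫ 𝟙 _ ≫ (nat g ((F.map f).toFunctor.obj x)).hom ≫ 𝟙 _ ≫
      (G.map g).toFunctor.map (nat f x).hom ≫ 𝟙 _
    refine congrArg _ (Eq.symm ((Category.id_comp _).trans (congrArg _ ?_)))
    exact (Category.id_comp _).trans (Category.comp_id _)

/-! ### Postcomposition with a pointwise fully faithful transformation. -/

section FullyFaithful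

variable (j : G ⟶ H)

theorem postcomp_faithful (hj : ∀ a, (j.app a).toFunctor.Faithful) (F : Pseudofunctor B Cat) :
    (Bicategory.postcomp F j).Faithful where
  map_injective h := hom_ext_app fun a x =>
    (hj a).map_injective (congrArg (fun k => (k.as.app a).toNatTrans.app x) h)

/-- Preimages are taken object by object; faithfulness of the components of `j` reduces the
modification axioms to those of `Γ`. -/
theorem postcomp_full (hj : ∀ a, (j.app a).toFunctor.FullyFaithful) (F : Pseudofunctor B Cat) :
    (Bicategory.postcomp F j).Full where
  map_surjective {η θ} (Γ : η ≫ j ⟶ θ ≫ j) := by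
    let γ (a : B) (x : F.obj a) : (j.app a).toFunctor.obj ((η.app a).toFunctor.obj x) ⟶
      (j.app a).toFunctor.obj ((θ.app a).toFunctor.obj x) := (Γ.as.app a).toNatTrans.app x
    refine ⟨homMkApp (fun a x => (hj a).preimage (γ a x))
      (fun a x y φ => (hj a).map_injective ?_) (fun {a b} f x => (hj b).map_injective ?_),
      hom_ext_app fun a x => (hj a).map_preimage _⟩
    · rw [Functor.map_comp, Functor.map_comp, (hj a).map_preimage, (hj a).map_preimage]
      exact (Γ.as.app a).toNatTrans.naturality φ
    · have h := modification_naturality_app Γ f x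
      rw [natApp_comp_hom, natApp_comp_hom] at h
      -- The naturality isomorphism of `j` moves `j` inside the restriction along `f`, where it
      -- meets its own preimage.
      rw [← cancel_mono (natApp j f _).hom, Functor.map_comp, Functor.map_comp, Category.assoc,
        Category.assoc, natApp_naturality, (hj b).map_preimage, (hj a).map_preimage]
      exact h.trans (Category.assoc _ _ _)

variable {j}

section Lift

variable (hj : ∀ a, (j.app a).toFunctor.FullyFaithful) (g : F ⟶ H) (k : ∀ a, F.obj a ⥤ G.obj a)
  (β : ∀ a (x : F.obj a), (j.app a).toFunctor.obj ((k a).obj x) ≅ (g.app a).toFunctor.obj x)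

/-- The naturality isomorphisms of the lift of a pseudonatural transformation along a pointwise
fully faithful one. -/
def liftNat {a b : B} (f : a ⟶ b) (x : F.obj a) :
    (k b).obj ((F.map f).toFunctor.obj x) ≅ (G.map f).toFunctor.obj ((k a).obj x) :=
  (hj b).preimageIso (β b _ ≪≫ natApp g f x ≪≫ (H.map f).toFunctor.mapIso (β a x).symm ≪≫
    (natApp j f ((k a).obj x)).symm)

/-- This square determines `liftNat`, because `j` is faithful and the other maps are invertible. The
coherence of the lift uses nothing else about it. -/
theorem map_liftNat {a b : B} (f : a ⟶ b) (x : F.obj a) :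
    (j.app b).toFunctor.map (liftNat hj g k β f x).hom ≫ (natApp j f ((k a).obj x)).hom ≫
      (H.map f).toFunctor.map (β a x).hom = (β b _).hom ≫ (natApp g f x).hom := by
  simp [liftNat, ← Functor.map_comp]

variable (hβ : ∀ (a : B) {x y : F.obj a} (φ : x ⟶ y),
  (j.app a).toFunctor.map ((k a).map φ) ≫ (β a y).hom = (β a x).hom ≫ (g.app a).toFunctor.map φ)

/-- The lift of a pseudonatural transformation `g : F ⟶ H` along a pointwise fully faithful
`j : G ⟶ H`, given pointwise lifts. -/
def lift : F ⟶ G :=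
  mkApp k (liftNat hj g k β)
    (fun {a b} f x y φ => by
      -- Each axiom is tested after applying `j` and composing with invertible comparison maps to
      -- `H`; there it becomes the same axiom for `g`.
      apply (hj b).map_injective
      rw [← cancel_mono (natApp j f _).hom, ← cancel_mono ((H.map f).toFunctor.map (β a y).hom)]
      simp only [Functor.map_comp, Category.assoc]
      rw [map_liftNat, reassoc_of% (hβ b), natApp_naturality, reassoc_of% @natApp_naturality,
        ← Functor.map_comp, hβ, Functor.map_comp, reassoc_of% @map_liftNat])
    (fun {a b f f'} θ x => by
      apply (hj b).map_injective
      rw [← cancel_mono (natApp j f' _).hom, ← cancel_mono ((H.map f').toFunctor.map (β a x).hom)]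
      simp only [Functor.map_comp, Category.assoc]
      rw [map_liftNat, reassoc_of% (hβ b), natApp_map₂, reassoc_of% @natApp_map₂,
        ← NatTrans.naturality, reassoc_of% @map_liftNat])
    (fun a x => by
      apply (hj a).map_injective
      rw [← cancel_mono (β a x).hom, hβ, Functor.map_comp, ← natApp_id, ← natApp_id,
        Category.assoc, Category.assoc, ← mapIdApp_naturality, reassoc_of% @map_liftNat])
    (fun {a b c} f f' x => by
      apply (hj c).map_injective
      -- Here `j` has to pass two restrictions before `β` can be reached, hence two cancelled
      -- naturality isomorphisms.
      rw [← cancel_mono (natApp j f' _).hom,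
        ← cancel_mono ((H.map f').toFunctor.map (natApp j f _).hom),
        ← cancel_mono ((H.map f').toFunctor.map ((H.map f).toFunctor.map (β a x).hom))]
      simp only [Functor.map_comp, Category.assoc]
      rw [← reassoc_of% @natApp_comp, ← mapCompApp_naturality, reassoc_of% @map_liftNat, natApp_comp,
        reassoc_of% @natApp_naturality, ← Functor.map_comp, ← Functor.map_comp, map_liftNat,
        Functor.map_comp, reassoc_of% @map_liftNat, reassoc_of% (hβ c)])

/-- The lift of `g` along `j` composes with `j` to `g`, up to isomorphism. -/
def liftCompIso : lift hj g k β hβ ≫ j ≅ g :=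
  isoMkApp β (fun a _ _ φ => hβ a φ) (fun f x => by
    rw [natApp_comp_hom]
    exact ((Category.assoc _ _ _).trans (map_liftNat hj g k β f x)).symm)

end Lift

/-- A pseudonatural transformation factors, up to isomorphism, through a pointwise fully faithful
one if and only if it does so at every object. -/
theorem essImage_postcomp_iff (hj : ∀ a, (j.app a).toFunctor.FullyFaithful) (g : F ⟶ H) :
    (Bicategory.postcomp F j).essImage g ↔
      ∀ a x, (j.app a).toFunctor.essImage ((g.app a).toFunctor.obj x) := by
  constructor
  · rintro ⟨k, ⟨i⟩⟩ a x
    exact ⟨(k.app a).toFunctor.obj x, ⟨isoApp i a x⟩⟩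
  · intro h
    choose obj β using h
    let β' a x := (β a x).some
    -- The objects are arbitrary choices; the action on morphisms is then forced by naturality of
    -- `β'`.
    let k (a : B) : F.obj a ⥤ G.obj a :=
      { obj := obj a
        map φ := (hj a).preimage ((β' a _).hom ≫ (g.app a).toFunctor.map φ ≫ (β' a _).inv)
        map_id x := (hj a).map_injective (by simp)
        map_comp φ ψ := (hj a).map_injective (by simp) }
    exact ⟨lift hj g k β' fun a x y φ => by simp [k], ⟨liftCompIso _ _ _ _ _⟩⟩

end FullyFaithful

end CategoryTheory.Pseudofunctor.StrongTrans

/-! ### Reduction to the value at the identity of `V`. -/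

namespace LocTriv

open Pseudofunctor.StrongTrans

variable {C : Type u} [Category.{v} C]

/-- The components of an f.f. morphism are fully faithful. -/
noncomputable def IsFf.fullyFaithful {X Y : ParamCat.{w, w', v, u} C} {f : X ⟶ Y} (hf : IsFf f)
    (a : LocallyDiscrete Cᵒᵖ) : (f.app a).toFunctor.FullyFaithful :=
  have := (hf a).1
  have := (hf a).2
  .ofFullyFaithful _

/-- The essential image of an f.f. part is the essential image of the whole morphism. -/
theorem EsoFfFactorization.essImage_j_iff {X Y : ParamCat.{w, w', v, u} C} {f : X ⟶ Y}
    (E : EsoFfFactorization f) (a : LocallyDiscrete Cᵒᵖ) (y : Y.obj a) :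
    (E.j.app a).toFunctor.essImage y ↔ (f.app a).toFunctor.essImage y := by
  constructor
  · rintro ⟨x, ⟨i⟩⟩
    -- Up to isomorphism `x` comes from the source of `f`, and there `E.iso` compares `j` after `s`
    -- with `f`.
    have := E.eso a
    exact ⟨_, ⟨(isoApp E.iso a _).symm ≪≫ (E.j.app a).toFunctor.mapIso
      ((E.s.app a).toFunctor.objObjPreimageIso x) ≪≫ i⟩⟩
  · rintro ⟨x, ⟨i⟩⟩
    exact ⟨(E.s.app a).toFunctor.obj x, ⟨isoApp E.iso a x ≪≫ i⟩⟩

/-- A morphism out of `P` lies pointwise in the image of `f` as soon as its composite with an e.s.o.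
morphism `s : V ⟶ P` sends the identity of `V` there. -/
theorem essImage_of_eso {X Y P : ParamCat.{w, w', v, u} C} (f : X ⟶ Y) {V : C}
    {s : rep.{w, w', v, u} V ⟶ P} (hs : IsEso s) (g : P ⟶ Y)
    (h : (f.app ⟨op V⟩).toFunctor.essImage
      ((g.app ⟨op V⟩).toFunctor.obj ((s.app ⟨op V⟩).toFunctor.obj ⟨𝟙 V⟩)))
    (a : LocallyDiscrete Cᵒᵖ) (p : P.obj a) :
    (f.app a).toFunctor.essImage ((g.app a).toFunctor.obj p) := by
  have := hs a
  let z : HomObj.{w', v, u} a.as.unop V := (s.app a).toFunctor.objPreimage p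
  let i : (s.app a).toFunctor.obj z ≅ p := (s.app a).toFunctor.objObjPreimageIso p
  -- Yoneda: `z` is the restriction of `𝟙 V` along itself, so `p` is isomorphic to the restriction
  -- of `s(𝟙 V)` along `ζ`.
  let ζ : (⟨op V⟩ : LocallyDiscrete Cᵒᵖ) ⟶ a := z.hom.op.toLoc
  let k : ((rep.{w, w', v, u} V).map ζ).toFunctor.obj ⟨𝟙 V⟩ ≅ z :=
    homObjIso (congrArg HomObj.mk (Category.comp_id z.hom))
  obtain ⟨x, ⟨l⟩⟩ := h
  exact ⟨(X.map ζ).toFunctor.obj x, ⟨natApp f ζ x ≪≫ (Y.map ζ).toFunctor.mapIso l ≪≫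
    (natApp g ζ _).symm ≪≫ (g.app a).toFunctor.mapIso
      ((natApp s ζ _).symm ≪≫ (s.app a).toFunctor.mapIso k ≪≫ i)⟩⟩

/-- The value of `V ⟶ P ⟶ U ⟶ X` at the identity of `V` is `(Xe)x`. -/
noncomputable def inducedFunctorObjIso (X : ParamCat.{w, w', v, u} C) {V U : C} {e : V ⟶ U}
    {P : ParamCat.{w, w', v, u} C} {s : rep.{w, w', v, u} V ⟶ P} {e' : P ⟶ rep.{w, w', v, u} U}
    (i : s ≫ e' ≅ repMap e) (x : X.obj ⟨op U⟩) :
    (((inducedFunctor X e').obj x).app ⟨op V⟩).toFunctor.obj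
      ((s.app ⟨op V⟩).toFunctor.obj ⟨𝟙 V⟩) ≅ pullObj X e x :=
  (familyApp X x V).mapIso (isoApp i ⟨op V⟩ ⟨𝟙 V⟩) ≪≫
    (familyApp X x V).mapIso (homObjIso (congrArg HomObj.mk (Category.id_comp e)))

/-- The morphism `P ⟶ X` corresponding to `x` factors through the image of `t` if and only if `x`
is in `Loc(t; e)`. -/
theorem essImage_postcomp_j_iff {X : ParamCat.{w, w', v, u} C} {T V U : C} (t : X.obj ⟨op T⟩)
    {e : V ⟶ U} {P : ParamCat.{w, w', v, u} C} {s : rep.{w, w', v, u} V ⟶ P}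
    {e' : P ⟶ rep.{w, w', v, u} U} (h : IsEffectiveDescent X e s e')
    (Xt : EsoFfFactorization (family X t)) (x : X.obj ⟨op U⟩) :
    (Bicategory.postcomp P Xt.j).essImage ((inducedFunctor X e').obj x) ↔
      locProperty X t e x := by
  obtain ⟨i⟩ := h.fac
  rw [essImage_postcomp_iff Xt.ff.fullyFaithful]
  simp only [Xt.essImage_j_iff]
  constructor
  · intro H
    obtain ⟨z, ⟨l⟩⟩ := H ⟨op V⟩ ((s.app ⟨op V⟩).toFunctor.obj ⟨𝟙 V⟩)
    exact ⟨z.hom, ⟨(inducedFunctorObjIso X i x).symm ≪≫ l.symm⟩⟩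
  · rintro ⟨z, ⟨l⟩⟩
    exact essImage_of_eso _ h.eso _ ⟨⟨z⟩, ⟨l.symm ≪≫ (inducedFunctorObjIso X i x).symm⟩⟩

end LocTriv

/-! ### Comparison of full subcategories and conclusion. -/

/-- A fully faithful functor and an equivalence with a common target identify the source of the
former with the full subcategory of the source of the latter on its essential image. -/
theorem CategoryTheory.Functor.nonempty_equivalence_fullSubcategory
    {A D E : Type*} [Category* A] [Category* D] [Category* E] (G : A ⥤ E) [G.Full] [G.Faithful]
    (F : D ⥤ E) [F.IsEquivalence] (Q : ObjectProperty D)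
    (hQ : ∀ d, G.essImage (F.obj d) ↔ Q d) : Nonempty (A ≌ Q.FullSubcategory) := by
  have hmem a : Q ((G ⋙ F.inv).obj a) :=
    (hQ _).1 ⟨a, ⟨(F.asEquivalence.counitIso.app (G.obj a)).symm⟩⟩
  have : (Q.lift (G ⋙ F.inv) hmem).EssSurj := ⟨by
    rintro ⟨d, hd⟩
    obtain ⟨a, ⟨i⟩⟩ := (hQ d).2 hd
    exact ⟨a, ⟨Q.isoMk (F.inv.mapIso i ≪≫ (F.asEquivalence.unitIso.app d).symm)⟩⟩⟩
  -- Fullness and faithfulness are found by instance search, inherited from `G ⋙ F.inv`.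
  have : (Q.lift (G ⋙ F.inv) hmem).IsEquivalence := {}
  exact ⟨(Q.lift (G ⋙ F.inv) hmem).asEquivalence⟩

theorem theorem6 {C : Type u} [Category.{v} C] (X : LocTriv.ParamCat.{w, w', v, u} C)
    {T V U : C} (t : X.obj ⟨op T⟩) (e : V ⟶ U)
    {P : LocTriv.ParamCat.{w, w', v, u} C}
    (s : LocTriv.rep.{w, w', v, u} V ⟶ P) (e' : P ⟶ LocTriv.rep.{w, w', v, u} U)
    (h : LocTriv.IsEffectiveDescent X e s e')
    (Xt : LocTriv.EsoFfFactorization (LocTriv.family X t)) :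
    Nonempty ((P ⟶ Xt.obj) ≌ LocTriv.Loc X t e) := by
  have := Pseudofunctor.StrongTrans.postcomp_faithful Xt.j (fun a => (Xt.ff a).2) P
  have := Pseudofunctor.StrongTrans.postcomp_full Xt.j Xt.ff.fullyFaithful P
  have := h.equiv
  exact (Bicategory.postcomp P Xt.j).nonempty_equivalence_fullSubcategory
    (LocTriv.inducedFunctor X e') _ (LocTriv.essImage_postcomp_j_iff t h Xt)
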